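/- Let $\Bbbk=\mathbb{R}$ or $\mathbb{C}$, let $d\geq 1$, $k\geq 1$, $N=\binom{d+k}{k}$, and let $\Bbbk_k[x]$ denote the space of polynomials in $x=(x^1,\dots,x^d)$ of total degree at most $k$. For a multi-index $r=(r^1,\dots,r^d)\in\mathbb{Z}_{\geq 0}^d$ put $\partial^r=(\partial/\partial x^1)^{r^1}\cdots(\partial/\partial x^d)^{r^d}$ and $|r|=r^1+\dots+r^d$. The complete generalised Wronskian determinant of order $k$ is the $N$-ary bracket $W_d^k(f_1,\dots,f_N)=\det(\partial^{r_i}f_j)_{1\leq i,j\leq N}$ on $\Bbbk[x]=\Bbbk[x^1,\dots,x^d]$, where $r_1,\dots,r_N$ are all the multi-indices with $|r|\leq k$. Let $\mathcal{A}$ be a linear subspace of $\Bbbk[x]$ that is closed under $W_d^k$ and consistent, i.e. $\Bbbk_k[x]\subsetneq\mathcal{A}$. Call $\mathcal{A}$ * *lonely* if $\mathcal{A}=\Bbbk_k[x]\oplus\langle p\rangle$ for some nonzero homogeneous polynomial $p$ of degree $k+1$; * *chubby* if $\mathcal{A}\supseteq\Bbbk_k[x]\oplus\langle p,q\rangle$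 (a direct sum) for some linearly independent polynomials $p,q$ of degree $k+1$; * *lanky* if $\mathcal{A}$ contains the monomial $(x^i)^{k+\ell}$ for some $i\in\{1,\dots,d\}$ and some $\ell\geq 2$. Then: 1. If $\mathcal{A}$ is not lonely, then $\dim_\Bbbk\mathcal{A}=+\infty$. 2. If $\mathcal{A}$ is chubby or lanky, then $\mathcal{A}$ is not lonely, and so $\dim_\Bbbk\mathcal{A}=+\infty$. 3. If $(x^i)^{k+\ell}\in\mathcal{A}$ with $\ell\geq 2$, then $(x^i)^{k+1},\dots,(x^i)^{k+\ell}\in\mathcal{A}$. 4. If $\mathcal{A}$ is spanned by monomials, then $\mathcal{A}$ is not lonely if and only if it is chubby or lanky. -/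

import Mathlib

open MvPolynomial

noncomputable section

namespace GenWronskian

/-- The multi-indices `r = (r¹, …, r^d)` of total order `|r| ≤ k`. They label both the rows and the
arguments of the complete generalised Wronskian. -/
def multiIndices (d k : ℕ) : Finset (Fin d →₀ ℕ) :=
  (Finset.range (k + 1)).biUnion fun n => Finset.finsuppAntidiag Finset.univ n

theorem mem_multiIndices {d k : ℕ} {r : Fin d →₀ ℕ} :
    r ∈ multiIndices d k ↔ ∑ i, r i ≤ k := by
  simp [multiIndices, Finset.mem_finsuppAntidiag]

/-- The number `N` of arguments of the Wronskian of order `k` over dimension `d`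
is `(d + k).choose k`. -/
theorem card_multiIndices (d k : ℕ) : (multiIndices d k).card = (d + k).choose k := by
  rw [multiIndices, Finset.card_biUnion]
  · simp only [Finset.card_finsuppAntidiag_nat_eq_multichoose, Finset.card_univ, Fintype.card_fin]
    rw [Nat.sum_range_multichoose]
    rw [add_comm k d, Nat.choose_symm_add]
  · intro m _ n _ hmn
    rw [Function.onFun, Finset.disjoint_left]
    intro r hr hr'
    rw [Finset.mem_finsuppAntidiag] at hr hr'
    exact hmn (hr.1.symm.trans hr'.1)

variable {𝕜 : Type*} [Field 𝕜] {d : ℕ}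

/-- The differential operator `∂^{|r|} / ∂x^r = (∂/∂x¹)^{r¹} ∘ ⋯ ∘ (∂/∂x^d)^{r^d}`
on `𝕜[x¹, …, x^d]`. -/
def diffOp (r : Fin d →₀ ℕ) : Module.End 𝕜 (MvPolynomial (Fin d) 𝕜) :=
  (List.ofFn fun i : Fin d =>
    ((pderiv i).toLinearMap : Module.End 𝕜 (MvPolynomial (Fin d) 𝕜)) ^ r i).prod

/-- The complete generalised Wronskian determinant `W_d^k` of differential order `k` over
dimension `d`. Its `N = (d + k).choose k` arguments are labelled by the multi-indices of order at
most `k`; another labelling of arguments or rows changes the determinant at most by a sign. -/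
def wronskian (k : ℕ) (f : multiIndices d k → MvPolynomial (Fin d) 𝕜) :
    MvPolynomial (Fin d) 𝕜 :=
  Matrix.det (Matrix.of fun r j : multiIndices d k => diffOp (r : Fin d →₀ ℕ) (f j))

/-- `A` is a polynomial algebra with the bracket `W_d^k`: the linear subspace `A` of
`𝕜[x¹, …, x^d]` is closed under the bracket. -/
def IsWronskianClosed (k : ℕ) (A : Submodule 𝕜 (MvPolynomial (Fin d) 𝕜)) : Prop :=
  ∀ f : multiIndices d k → MvPolynomial (Fin d) 𝕜, (∀ j, f j ∈ A) → wronskian k f ∈ A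

/-- `A` is consistent: it properly contains the space `𝕜_k[x]` of all polynomials of
total degree at most `k`. -/
def IsConsistent (k : ℕ) (A : Submodule 𝕜 (MvPolynomial (Fin d) 𝕜)) : Prop :=
  restrictTotalDegree (Fin d) 𝕜 k < A

/-- `A` is lonely: `A = 𝕜_k[x] ⊕ ⟨p⟩` for a nonzero homogeneous polynomial `p` of
degree `k + 1`. -/
def IsLonely (k : ℕ) (A : Submodule 𝕜 (MvPolynomial (Fin d) 𝕜)) : Prop :=
  ∃ p : MvPolynomial (Fin d) 𝕜, p ≠ 0 ∧ p.IsHomogeneous (k + 1) ∧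
    A = restrictTotalDegree (Fin d) 𝕜 k ⊔ Submodule.span 𝕜 {p}

/-- `A` is chubby: `A ⊇ 𝕜_k[x] ⊕ ⟨p, q⟩` (a direct sum) for two linearly independent
polynomials `p`, `q` of degree `k + 1`. -/
def IsChubby (k : ℕ) (A : Submodule 𝕜 (MvPolynomial (Fin d) 𝕜)) : Prop :=
  ∃ p q : MvPolynomial (Fin d) 𝕜, p.totalDegree = k + 1 ∧ q.totalDegree = k + 1 ∧
    LinearIndependent 𝕜 ![p, q] ∧
    Disjoint (restrictTotalDegree (Fin d) 𝕜 k) (Submodule.span 𝕜 {p, q}) ∧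
    restrictTotalDegree (Fin d) 𝕜 k ⊔ Submodule.span 𝕜 {p, q} ≤ A

/-- `A` is lanky: it contains `𝕜_k[x]` and a power `(x^i)^{k+ℓ}`, `ℓ ≥ 2`, of a coordinate. -/
def IsLanky (k : ℕ) (A : Submodule 𝕜 (MvPolynomial (Fin d) 𝕜)) : Prop :=
  restrictTotalDegree (Fin d) 𝕜 k ≤ A ∧
    ∃ (i : Fin d) (l : ℕ), 2 ≤ l ∧ (X i : MvPolynomial (Fin d) 𝕜) ^ (k + l) ∈ A

/-- `A` is the linear span of a set of pure monomials. -/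
def IsSpannedByMonomials (A : Submodule 𝕜 (MvPolynomial (Fin d) 𝕜)) : Prop :=
  ∃ S : Set (Fin d →₀ ℕ),
    A = Submodule.span 𝕜 ((fun s => monomial s (1 : 𝕜)) '' S)

end GenWronskian

end

/-!
For a multi-index `t` of order at most `k` let `D_t = ∑_r (-x)^{r - t} / (r - t)! ∂^r`, summed over
the multi-indices `r ≥ t` of order at most `k` (`taylorCoeff`). On a homogeneous polynomial of
degree `n` Vandermonde's identity turns `D_t` into a scalar multiple of `∂^t`, the scalar being
`∑_{j ≤ k - |t|} (-1)^j C(n - |t|, j) = (-1)^{k - |t|} C(n - |t| - 1, k - |t|)` for `n > |t|`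
(`taylorCoeff_of_isHomogeneous`). It follows that the divided powers `x^s / s!` with `|s| ≤ k` form
the basis dual to the `D_t` (`taylorCoeff_divPow`), so that the matrix expressing the `D_t` through
the `∂^r` is invertible and has a constant determinant. Hence the Wronskian may be computed with the
`D_t` in place of the `∂^r`, and filling all but one or two of its arguments with divided powers
shows that `A` is closed under every `D_t` and under `D_t f · D_t' g - D_t' f · D_t g` for `t ≠ t'`.

Three consequences carry the theorem.
* `D_0` acts on the polynomials of degree `n > k` by `± C(n - 1, k)`, and these numbers are
  distinct, so `A` is a graded subspace (`IsWronskianClosed.homogeneousComponent_mem`).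
* `D_t` with `t` a unit vector shows that `A` is closed under `∂ᵢ` (`IsWronskianClosed.pderiv_mem`).
* With `t = 0` and `t'` a unit vector, `A` contains `(m - 1) f ∂ᵢg - (n - 1) g ∂ᵢf` for
  `f`, `g` in `A` homogeneous of degrees `m, n > k` (`IsWronskianClosed.bracket_mem`).

Suppose that `A` is finite-dimensional, and let `m > k` be its top degree. The bracket of two forms
`f`, `g` of degree `m` has degree `2m - 1 > m`, so `f ∂ᵢg = g ∂ᵢf` for all `i`, which makes `f` and
`g` proportional: the part of degree `m` is a line. If `m ≥ k + 2`, the bracket of `p` in this line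
with a derivative `∂ᵢp ≠ 0` has degree `2m - 2 > m`, and its vanishing contradicts Euler's identity
because `(m - 1)² ≠ m (m - 2)`. So `m = k + 1` and `A` is lonely. The remaining assertions follow
from the grading and the closure under derivatives.
-/

noncomputable section

namespace GenWronskian

variable {𝕜 : Type*} [Field 𝕜] {d : ℕ}

/-! ### The operators `∂^r` on monomials -/

theorem mem_multiIndices_iff_degree {k : ℕ} {r : Fin d →₀ ℕ} :
    r ∈ multiIndices d k ↔ r.degree ≤ k := by
  rw [mem_multiIndices, Finsupp.degree_eq_sum]

theorem pderiv_pow_monomial (i : Fin d) (n : ℕ) (s : Fin d →₀ ℕ) (a : 𝕜) :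
    (((pderiv i).toLinearMap : Module.End 𝕜 (MvPolynomial (Fin d) 𝕜)) ^ n) (monomial s a) =
      monomial (s - Finsupp.single i n) (a * ((s i).descFactorial n : 𝕜)) := by
  induction n with
  | zero => simp
  | succ n ih =>
    rw [pow_succ', Module.End.mul_apply, ih]
    simp only [Derivation.coeFn_coe, pderiv_monomial, Finsupp.coe_tsub, Pi.sub_apply,
      Finsupp.single_eq_same]
    rw [tsub_tsub, ← Finsupp.single_add, mul_assoc, Nat.descFactorial_succ, mul_comm (s i - n)]
    push_cast
    rfl

theorem list_prod_pderiv_pow_monomial (r : Fin d →₀ ℕ) (l : List (Fin d)) (hl : l.Nodup)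
    (s : Fin d →₀ ℕ) (a : 𝕜) :
    (l.map fun i => ((pderiv i).toLinearMap : Module.End 𝕜 (MvPolynomial (Fin d) 𝕜)) ^ r i).prod
        (monomial s a) =
      monomial (s - (l.map fun i => Finsupp.single i (r i)).sum)
        (a * (l.map fun i => ((s i).descFactorial (r i) : 𝕜)).prod) := by
  induction l with
  | nil => simp
  | cons i l ih =>
    rw [List.nodup_cons] at hl
    have hi : (l.map fun j => Finsupp.single j (r j)).sum i = 0 := by
      rw [← Finsupp.applyAddHom_apply, map_list_sum, List.map_map]
      apply List.sum_eq_zero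
      intro x hx
      obtain ⟨j, hj, rfl⟩ := List.mem_map.1 hx
      have : i ≠ j := fun h => hl.1 (h ▸ hj)
      simp [this]
    rw [List.map_cons, List.prod_cons, Module.End.mul_apply, ih hl.2, pderiv_pow_monomial]
    simp only [List.map_cons, List.sum_cons, List.prod_cons, Finsupp.coe_tsub, Pi.sub_apply, hi,
      tsub_zero]
    rw [tsub_tsub, add_comm (Finsupp.single i (r i)), mul_assoc, mul_comm (List.prod _)]

theorem diffOp_monomial (r s : Fin d →₀ ℕ) (a : 𝕜) :
    diffOp r (monomial s a) =
      monomial (s - r) (a * ∏ i, ((s i).descFactorial (r i) : 𝕜)) := by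
  rw [diffOp, List.ofFn_eq_map, list_prod_pderiv_pow_monomial r _ (List.nodup_finRange d)]
  rw [← List.ofFn_eq_map, ← List.ofFn_eq_map, List.sum_ofFn, List.prod_ofFn,
    Finsupp.univ_sum_single]

theorem diffOp_zero (f : MvPolynomial (Fin d) 𝕜) : diffOp 0 f = f := by
  simp [diffOp]

theorem diffOp_single (i : Fin d) (f : MvPolynomial (Fin d) 𝕜) :
    diffOp (Finsupp.single i 1) f = pderiv i f := by
  induction f using MvPolynomial.induction_on' with
  | monomial s a =>
    rw [diffOp_monomial, pderiv_monomial, Finset.prod_eq_single i]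
    · simp
    · intro j _ hj
      simp [Finsupp.single_eq_of_ne hj]
    · simp
  | add p q hp hq => simp [hp, hq]

/-! ### Alternating sums of products of binomial coefficients -/

/-- Vandermonde's identity for products of several binomial coefficients. -/
theorem sum_prod_choose_finsuppAntidiag (n : Fin d →₀ ℕ) (j : ℕ) :
    ∑ u ∈ Finset.finsuppAntidiag Finset.univ j, ∏ i, (n i).choose (u i) =
      n.degree.choose j := by
  have h : ∏ i, (1 + PowerSeries.X : PowerSeries ℕ) ^ n i = (1 + PowerSeries.X) ^ n.degree := by
    rw [Finset.prod_pow_eq_pow_sum, Finsupp.degree_eq_sum]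
  have key : ∀ m j : ℕ, PowerSeries.coeff j ((1 + PowerSeries.X : PowerSeries ℕ) ^ m)
      = m.choose j := by
    intro m j
    have := Polynomial.coeff_one_add_X_pow ℕ m j
    rw [← Polynomial.coeff_coe] at this
    simpa using this
  have := congrArg (PowerSeries.coeff j) h
  rw [PowerSeries.coeff_prod, key] at this
  simpa only [key] using this

/-- The alternating binomial sum `∑_{j ≤ q} (-1)^j C(n, j)`: the scalar by which the operators
`taylorCoeff` differ from plain derivatives on homogeneous polynomials. -/
def altChoose (q n : ℕ) : ℤ := ∑ j ∈ Finset.range (q + 1), (-1) ^ j * (n.choose j : ℤ)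

theorem altChoose_succ (q n : ℕ) : altChoose q (n + 1) = (-1) ^ q * (n.choose q : ℤ) :=
  Int.alternating_sum_range_choose_eq_choose

theorem altChoose_zero_right (q : ℕ) : altChoose q 0 = 1 := by
  rw [altChoose, Finset.sum_range_succ']
  simp

theorem sum_multiIndices_neg_one_pow_mul_prod_choose (q : ℕ) (n : Fin d →₀ ℕ) :
    ∑ u ∈ multiIndices d q, (-1 : ℤ) ^ u.degree * ∏ i, ((n i).choose (u i) : ℤ) =
      altChoose q n.degree := by
  rw [multiIndices, Finset.sum_biUnion]
  · refine Finset.sum_congr rfl fun j _ => ?_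
    rw [← sum_prod_choose_finsuppAntidiag, Nat.cast_sum, Finset.mul_sum]
    refine Finset.sum_congr rfl fun u hu => ?_
    rw [Finset.mem_finsuppAntidiag] at hu
    rw [Finsupp.degree_eq_sum, hu.1, Nat.cast_prod]
  · intro m _ n _ hmn
    rw [Function.onFun, Finset.disjoint_left]
    intro r hr hr'
    rw [Finset.mem_finsuppAntidiag] at hr hr'
    exact hmn (hr.1.symm.trans hr'.1)

/-! ### Coefficients of Taylor polynomials -/

/-- The divided power `x^s / s!`. -/
def divPow (s : Fin d →₀ ℕ) : MvPolynomial (Fin d) 𝕜 :=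
  monomial s (∏ i, ((s i).factorial : 𝕜))⁻¹

/-- The monomial `(-x)^u / u!`. -/
def negDivPow (u : Fin d →₀ ℕ) : MvPolynomial (Fin d) 𝕜 :=
  monomial u ((-1) ^ u.degree * (∏ i, ((u i).factorial : 𝕜))⁻¹)

/-- The operator `f ↦ ∑_r (-x)^{r - t} / (r - t)! · ∂^r f`, the sum over all multi-indices `r ≥ t`
of order at most `k`. Its value is the coefficient of `y^t / t!` in the Taylor polynomial of `f` at
the point `x` of order `k`, written in powers of the coordinate `y` rather than of `y - x`. -/
def taylorCoeff (k : ℕ) (t : Fin d →₀ ℕ) : Module.End 𝕜 (MvPolynomial (Fin d) 𝕜) :=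
  ∑ r ∈ multiIndices d k with t ≤ r, LinearMap.mulLeft 𝕜 (negDivPow (r - t)) ∘ₗ diffOp r

theorem taylorCoeff_apply (k : ℕ) (t : Fin d →₀ ℕ) (f : MvPolynomial (Fin d) 𝕜) :
    taylorCoeff k t f = ∑ r ∈ multiIndices d k with t ≤ r, negDivPow (r - t) * diffOp r f := by
  simp [taylorCoeff, LinearMap.sum_apply]

theorem filter_le_multiIndices {k : ℕ} {t : Fin d →₀ ℕ} (ht : t.degree ≤ k) :
    (multiIndices d k).filter (t ≤ ·) =
      (multiIndices d (k - t.degree)).map (addLeftEmbedding t) := by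
  ext r
  simp only [Finset.mem_filter, Finset.mem_map, mem_multiIndices_iff_degree, addLeftEmbedding_apply]
  constructor
  · rintro ⟨hr, htr⟩
    refine ⟨r - t, ?_, add_tsub_cancel_of_le htr⟩
    have := congrArg Finsupp.degree (add_tsub_cancel_of_le htr)
    rw [map_add] at this
    lia
  · rintro ⟨u, hu, rfl⟩
    rw [map_add]
    exact ⟨by lia, le_self_add⟩

theorem diffOp_monomial_eq_zero {r s : Fin d →₀ ℕ} (h : ¬ r ≤ s) (a : 𝕜) :
    diffOp r (monomial s a) = 0 := by
  rw [Finsupp.le_def, not_forall] at h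
  obtain ⟨i, hi⟩ := h
  rw [diffOp_monomial, Finset.prod_eq_zero (Finset.mem_univ i), mul_zero, monomial_zero]
  rw [Nat.descFactorial_eq_zero_iff_lt.2 (not_le.1 hi), Nat.cast_zero]

theorem negDivPow_mul_diffOp_monomial [CharZero 𝕜] (t u n : Fin d →₀ ℕ) (a : 𝕜) :
    negDivPow u * diffOp (t + u) (monomial (t + n) a) =
      (((-1 : ℤ) ^ u.degree * ∏ i, ((n i).choose (u i) : ℤ) : ℤ) : 𝕜) •
        diffOp t (monomial (t + n) a) := by
  by_cases h : u ≤ n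
  · have hexp : u + (t + n - (t + u)) = t + n - t := by
      rw [add_tsub_add_eq_tsub_left, add_tsub_cancel_of_le h, add_tsub_cancel_left]
    rw [diffOp_monomial, diffOp_monomial, negDivPow, monomial_mul, smul_monomial, hexp]
    congr 1
    have hprod : (∏ i, (((t + n) i).descFactorial ((t + u) i) : 𝕜)) =
        (∏ i, ((u i).factorial : 𝕜)) * (∏ i, ((n i).choose (u i) : 𝕜)) *
          ∏ i, (((t + n) i).descFactorial (t i) : 𝕜) := by
      rw [← Finset.prod_mul_distrib, ← Finset.prod_mul_distrib]
      refine Finset.prod_congr rfl fun i _ => ?_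
      rw [← Nat.cast_mul, ← Nat.cast_mul, ← Nat.descFactorial_eq_factorial_mul_choose]
      have := Nat.descFactorial_mul_descFactorial (n := t i + n i) (Nat.le_add_right (t i) (u i))
      simp only [add_tsub_cancel_left] at this
      simp only [Finsupp.coe_add, Pi.add_apply, this]
    have hu : (∏ i, ((u i).factorial : 𝕜)) ≠ 0 :=
      Finset.prod_ne_zero_iff.2 fun i _ => Nat.cast_ne_zero.2 (Nat.factorial_ne_zero _)
    rw [hprod]
    push_cast
    rw [smul_eq_mul]
    field_simp
  · rw [diffOp_monomial_eq_zero fun h' => h (le_of_add_le_add_left h'), mul_zero]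
    rw [Finsupp.le_def, not_forall] at h
    obtain ⟨i, hi⟩ := h
    rw [Finset.prod_eq_zero (Finset.mem_univ i)]
    · simp
    · rw [Nat.choose_eq_zero_of_lt (not_le.1 hi), Nat.cast_zero]

/-- On monomials, `taylorCoeff k t` is a multiple of `∂^t`, the factor depending on degrees only. -/
theorem taylorCoeff_monomial [CharZero 𝕜] {k : ℕ} {t : Fin d →₀ ℕ} (ht : t.degree ≤ k)
    (s : Fin d →₀ ℕ) (a : 𝕜) :
    taylorCoeff k t (monomial s a) =
      (altChoose (k - t.degree) (s.degree - t.degree) : 𝕜) • diffOp t (monomial s a) := by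
  rw [taylorCoeff_apply]
  by_cases hts : t ≤ s
  · obtain ⟨n, rfl⟩ := le_iff_exists_add.1 hts
    rw [filter_le_multiIndices ht, Finset.sum_map]
    simp only [addLeftEmbedding_apply, add_tsub_cancel_left, negDivPow_mul_diffOp_monomial]
    rw [← Finset.sum_smul, ← Int.cast_sum, sum_multiIndices_neg_one_pow_mul_prod_choose, map_add,
      add_tsub_cancel_left]
  · rw [diffOp_monomial_eq_zero hts, smul_zero]
    refine Finset.sum_eq_zero fun r hr => ?_
    rw [diffOp_monomial_eq_zero fun h => hts ((Finset.mem_filter.1 hr).2.trans h), mul_zero]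

theorem taylorCoeff_of_isHomogeneous [CharZero 𝕜] {k : ℕ} {t : Fin d →₀ ℕ} (ht : t.degree ≤ k)
    {n : ℕ} {f : MvPolynomial (Fin d) 𝕜} (hf : f.IsHomogeneous n) :
    taylorCoeff k t f = (altChoose (k - t.degree) (n - t.degree) : 𝕜) • diffOp t f := by
  conv_lhs => rw [f.as_sum]
  conv_rhs => rw [f.as_sum]
  rw [map_sum, map_sum, Finset.smul_sum]
  refine Finset.sum_congr rfl fun s hs => ?_
  have hsn : s.degree = n := by_contra fun h => mem_support_iff.1 hs (hf.coeff_eq_zero h)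
  rw [taylorCoeff_monomial ht, hsn]

/-- The divided powers `x^s / s!` of order at most `k` are the basis dual to the operators
`taylorCoeff k t`. -/
theorem taylorCoeff_divPow [CharZero 𝕜] {k : ℕ} {t s : Fin d →₀ ℕ} (ht : t.degree ≤ k)
    (hs : s.degree ≤ k) :
    taylorCoeff k t (divPow s : MvPolynomial (Fin d) 𝕜) = if t = s then 1 else 0 := by
  rw [divPow, taylorCoeff_monomial ht]
  split_ifs with h
  · subst h
    have hs : (∏ i, ((t i).factorial : 𝕜)) ≠ 0 :=
      Finset.prod_ne_zero_iff.2 fun i _ => Nat.cast_ne_zero.2 (Nat.factorial_ne_zero _)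
    rw [tsub_self, altChoose_zero_right, diffOp_monomial]
    simp only [Nat.descFactorial_self, tsub_self]
    rw [inv_mul_cancel₀ hs]
    simp
  · by_cases hts : t ≤ s
    · obtain ⟨n, rfl⟩ := le_iff_exists_add.1 hts
      have hn : n.degree ≠ 0 := fun h0 => h (by simp [(Finsupp.degree_eq_zero_iff n).1 h0])
      obtain ⟨m, hm⟩ := Nat.exists_eq_succ_of_ne_zero hn
      rw [map_add] at hs ⊢
      rw [add_tsub_cancel_left, hm, Nat.succ_eq_add_one, altChoose_succ,
        Nat.choose_eq_zero_of_lt (by lia)]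
      simp
    · rw [diffOp_monomial_eq_zero hts, smul_zero]

/-! ### Determinants with one or two replaced columns -/

theorem det_one_updateCol {n R : Type*} [Fintype n] [DecidableEq n] [CommRing R] (a : n)
    (u : n → R) : ((1 : Matrix n n R).updateCol a u).det = u a := by
  rw [← Matrix.cramer_apply, Matrix.cramer_one, Module.End.one_apply]

theorem det_one_updateCol_updateCol {n R : Type*} [Fintype n] [DecidableEq n] [CommRing R]
    {a b : n} (hab : a ≠ b) (u v : n → R) :
    (((1 : Matrix n n R).updateCol a u).updateCol b v).det = u a * v b - u b * v a := by
  have h : ((1 : Matrix n n R).updateCol a u).updateCol b v =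
      1 + (Matrix.of fun i (j : Fin 2) => ![u i - Pi.single (M := fun _ => R) a 1 i,
          v i - Pi.single (M := fun _ => R) b 1 i] j) *
        Matrix.of fun (j : Fin 2) i => ![Pi.single (M := fun _ => R) a 1 i,
          Pi.single (M := fun _ => R) b 1 i] j := by
    ext i j
    simp only [Matrix.add_apply, Matrix.mul_apply, Fin.sum_univ_two, Matrix.of_apply,
      Matrix.updateCol_apply, Matrix.one_apply, Pi.single_apply, Matrix.cons_val_zero,
      Matrix.cons_val_one]
    by_cases hjb : j = b
    · subst hjb
      simp [hab.symm]
    · by_cases hja : j = a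
      · subst hja
        simp [hab]
      · simp [hja, hjb]
  -- the perturbation of `1` has the form `UV` with `U` of two columns, and `1 + VU` is 2 × 2
  rw [h, Matrix.det_one_add_mul_comm, Matrix.det_fin_two]
  simp [Matrix.mul_apply, Pi.single_apply, hab, hab.symm, mul_comm]

/-! ### The Wronskian in terms of Taylor coefficients -/

/-- The matrix that expresses the operators `taylorCoeff k t` through the derivatives `∂^r`. -/
def taylorMatrix (𝕜 : Type*) [Field 𝕜] (d k : ℕ) :
    Matrix (multiIndices d k) (multiIndices d k) (MvPolynomial (Fin d) 𝕜) :=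
  Matrix.of fun t r => if (t : Fin d →₀ ℕ) ≤ r then negDivPow (r - t : Fin d →₀ ℕ) else 0

theorem taylorMatrix_mul (k : ℕ) (f : multiIndices d k → MvPolynomial (Fin d) 𝕜) :
    taylorMatrix 𝕜 d k * Matrix.of (fun r j : multiIndices d k => diffOp (r : Fin d →₀ ℕ) (f j)) =
      Matrix.of fun t j : multiIndices d k => taylorCoeff k t (f j) := by
  ext1 t j
  simp only [Matrix.mul_apply, taylorMatrix, Matrix.of_apply, taylorCoeff_apply, ite_mul, zero_mul]
  rw [Finset.sum_filter]
  exact Finset.sum_coe_sort (multiIndices d k) fun r : Fin d →₀ ℕ =>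
    if (t : Fin d →₀ ℕ) ≤ r then negDivPow (r - t : Fin d →₀ ℕ) * diffOp r (f j) else 0

theorem taylorCoeff_divPow_eq_one [CharZero 𝕜] {k : ℕ} (t s : multiIndices d k) :
    taylorCoeff k t (divPow (s : Fin d →₀ ℕ) : MvPolynomial (Fin d) 𝕜) =
      (1 : Matrix (multiIndices d k) (multiIndices d k) (MvPolynomial (Fin d) 𝕜)) t s := by
  rw [taylorCoeff_divPow (mem_multiIndices_iff_degree.1 t.2)
    (mem_multiIndices_iff_degree.1 s.2), Matrix.one_apply]
  simp only [Subtype.ext_iff]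

theorem isUnit_det_taylorMatrix [CharZero 𝕜] (k : ℕ) : IsUnit (taylorMatrix 𝕜 d k).det := by
  have h := taylorMatrix_mul k fun s : multiIndices d k =>
    (divPow (s : Fin d →₀ ℕ) : MvPolynomial (Fin d) 𝕜)
  have h1 : (Matrix.of fun t j : multiIndices d k =>
      taylorCoeff k t (divPow (j : Fin d →₀ ℕ) : MvPolynomial (Fin d) 𝕜)) = 1 := by
    ext1 t j
    exact taylorCoeff_divPow_eq_one t j
  rw [h1] at h
  have := congrArg Matrix.det h
  rw [Matrix.det_mul, Matrix.det_one] at this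
  exact IsUnit.of_mul_eq_one _ this

variable {k : ℕ} {A : Submodule 𝕜 (MvPolynomial (Fin d) 𝕜)}

/-- A subspace closed under the Wronskian contains the determinants formed with the operators
`taylorCoeff` in place of the derivatives: the two determinants differ by a constant. -/
theorem IsWronskianClosed.det_taylorCoeff_mem [CharZero 𝕜] (hA : IsWronskianClosed k A)
    {f : multiIndices d k → MvPolynomial (Fin d) 𝕜} (hf : ∀ j, f j ∈ A) :
    (Matrix.of fun t j : multiIndices d k => taylorCoeff k t (f j)).det ∈ A := by
  obtain ⟨c, -, hc⟩ := MvPolynomial.isUnit_iff_eq_C_of_isReduced.1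
    (isUnit_det_taylorMatrix (𝕜 := 𝕜) (d := d) k)
  rw [← taylorMatrix_mul, Matrix.det_mul, hc, C_mul']
  exact A.smul_mem c (hA f hf)

theorem divPow_mem (hk : restrictTotalDegree (Fin d) 𝕜 k ≤ A) (s : multiIndices d k) :
    divPow (s : Fin d →₀ ℕ) ∈ A :=
  hk ((mem_restrictTotalDegree _ _ _).2
    ((totalDegree_monomial_le _ _).trans (mem_multiIndices.1 s.2 |> fun h => by
      rwa [Finsupp.sum_fintype _ _ fun _ => rfl])))

/-- `taylorCoeff k t f` is, up to a nonzero constant, the Wronskian of the divided powers of order at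
most `k` with `x^t / t!` replaced by `f`. -/
theorem IsWronskianClosed.taylorCoeff_mem [CharZero 𝕜] (hA : IsWronskianClosed k A)
    (hk : restrictTotalDegree (Fin d) 𝕜 k ≤ A) {t : Fin d →₀ ℕ} (ht : t.degree ≤ k)
    {f : MvPolynomial (Fin d) 𝕜} (hf : f ∈ A) : taylorCoeff k t f ∈ A := by
  set a : multiIndices d k := ⟨t, mem_multiIndices_iff_degree.2 ht⟩ with ha
  have h := hA.det_taylorCoeff_mem
    (f := Function.update (fun s => divPow (s : Fin d →₀ ℕ)) a f) fun j => by
      rcases eq_or_ne j a with rfl | hj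
      · simpa using hf
      · simpa [hj] using divPow_mem hk j
  have hM : (Matrix.of fun r j : multiIndices d k => taylorCoeff k (r : Fin d →₀ ℕ)
      (Function.update (fun s : multiIndices d k => divPow (s : Fin d →₀ ℕ)) a f j)) =
      (1 : Matrix (multiIndices d k) (multiIndices d k) (MvPolynomial (Fin d) 𝕜)).updateCol a
        fun r => taylorCoeff k (r : Fin d →₀ ℕ) f := by
    ext1 r j
    rw [Matrix.of_apply, Matrix.updateCol_apply]
    split_ifs with hj
    · rw [hj, Function.update_self]
    · rw [Function.update_of_ne hj, taylorCoeff_divPow_eq_one]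
  rwa [hM, det_one_updateCol] at h

/-- The Wronskian of the divided powers of order at most `k` with `x^t / t!` and `x^t' / t'!` replaced
by `f` and `g`, up to a nonzero constant. -/
theorem IsWronskianClosed.taylorCoeff_mul_sub_mem [CharZero 𝕜] (hA : IsWronskianClosed k A)
    (hk : restrictTotalDegree (Fin d) 𝕜 k ≤ A) {t t' : Fin d →₀ ℕ} (ht : t.degree ≤ k)
    (ht' : t'.degree ≤ k) (hne : t ≠ t') {f g : MvPolynomial (Fin d) 𝕜} (hf : f ∈ A)
    (hg : g ∈ A) :
    taylorCoeff k t f * taylorCoeff k t' g - taylorCoeff k t' f * taylorCoeff k t g ∈ A := by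
  set a : multiIndices d k := ⟨t, mem_multiIndices_iff_degree.2 ht⟩ with ha
  set b : multiIndices d k := ⟨t', mem_multiIndices_iff_degree.2 ht'⟩ with hb
  have hab : a ≠ b := fun h => hne (congrArg Subtype.val h)
  have h := hA.det_taylorCoeff_mem
    (f := Function.update (Function.update (fun s => divPow (s : Fin d →₀ ℕ)) a f) b g)
    fun j => by
      rcases eq_or_ne j b with rfl | hjb
      · simpa using hg
      · rcases eq_or_ne j a with rfl | hja
        · simpa [hab] using hf
        · simpa [hja, hjb] using divPow_mem hk j
  have hM : (Matrix.of fun r j : multiIndices d k => taylorCoeff k (r : Fin d →₀ ℕ)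
      (Function.update (Function.update
        (fun s : multiIndices d k => divPow (s : Fin d →₀ ℕ)) a f) b g j)) =
      ((1 : Matrix (multiIndices d k) (multiIndices d k) (MvPolynomial (Fin d) 𝕜)).updateCol a
        fun r => taylorCoeff k (r : Fin d →₀ ℕ) f).updateCol b
          fun r => taylorCoeff k (r : Fin d →₀ ℕ) g := by
    ext1 r j
    rw [Matrix.of_apply, Matrix.updateCol_apply, Matrix.updateCol_apply]
    split_ifs with hjb hja
    · rw [hjb, Function.update_self]
    · rw [Function.update_of_ne hjb, hja, Function.update_self]
    · rw [Function.update_of_ne hjb, Function.update_of_ne hja, taylorCoeff_divPow_eq_one]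
  rwa [hM, det_one_updateCol_updateCol hab] at h

/-! ### Grading, derivatives and brackets in a closed subspace -/

theorem homogeneousComponent_taylorCoeff_zero [CharZero 𝕜] (k n : ℕ)
    (f : MvPolynomial (Fin d) 𝕜) :
    homogeneousComponent n (taylorCoeff k 0 f) =
      (altChoose k n : 𝕜) • homogeneousComponent n f := by
  induction f using MvPolynomial.induction_on' with
  | monomial s a =>
    have hs : monomial s a ∈ homogeneousSubmodule (Fin d) 𝕜 s.degree :=
      isHomogeneous_monomial a rfl
    rw [taylorCoeff_monomial (by simp), diffOp_zero, map_zero, tsub_zero, tsub_zero, map_smul,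
      homogeneousComponent_of_mem hs]
    split_ifs with h
    · rw [h]
    · rw [smul_zero, smul_zero]
  | add p q hp hq => rw [map_add, map_add, hp, hq, map_add, smul_add]

theorem altChoose_ne_of_lt {n m : ℕ} (hk : 1 ≤ k) (hn : k < n) (hnm : n < m) :
    altChoose k n ≠ altChoose k m := by
  obtain ⟨n, rfl⟩ := Nat.exists_eq_add_of_le' (Nat.one_le_of_lt hn)
  obtain ⟨m, rfl⟩ := Nat.exists_eq_add_of_le' (Nat.one_le_of_lt hnm)
  obtain ⟨q, rfl⟩ := Nat.exists_eq_add_of_le' hk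
  rw [altChoose_succ, altChoose_succ]
  intro h
  have h' := mul_left_cancel₀ (pow_ne_zero _ (by norm_num)) h
  have h1 : n.choose (q + 1) < (n + 1).choose (q + 1) := by
    rw [Nat.choose_succ_succ]
    have := Nat.choose_pos (n := n) (k := q) (by lia)
    lia
  have h2 : (n + 1).choose (q + 1) ≤ m.choose (q + 1) := Nat.choose_le_choose _ (by lia)
  have h3 : n.choose (q + 1) = m.choose (q + 1) := by exact_mod_cast h'
  lia

/-- `A` is a graded subspace: `taylorCoeff k 0` acts on it with distinct eigenvalues on the
homogeneous parts of degree greater than `k`. -/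
theorem IsWronskianClosed.homogeneousComponent_mem [CharZero 𝕜] (hA : IsWronskianClosed k A)
    (hk : 1 ≤ k) (hkA : restrictTotalDegree (Fin d) 𝕜 k ≤ A) {f : MvPolynomial (Fin d) 𝕜}
    (hf : f ∈ A) (n : ℕ) : homogeneousComponent n f ∈ A := by
  suffices h : ∀ (N : ℕ) (f : MvPolynomial (Fin d) 𝕜), f ∈ A →
      (∀ n, N < n → homogeneousComponent n f = 0) → ∀ n, homogeneousComponent n f ∈ A from
    h f.totalDegree f hf (fun n hn => homogeneousComponent_eq_zero n f hn) n
  have hlow : ∀ (f : MvPolynomial (Fin d) 𝕜) (n : ℕ), n ≤ k → homogeneousComponent n f ∈ A :=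
    fun f n hn => hkA ((mem_restrictTotalDegree _ _ _).2
      ((homogeneousComponent_isHomogeneous n f).totalDegree_le.trans hn))
  intro N
  induction N with
  | zero =>
    intro f _ hN n
    rcases Nat.eq_zero_or_pos n with rfl | hn
    · exact hlow f 0 (Nat.zero_le k)
    · rw [hN n hn]
      exact A.zero_mem
  | succ N ih =>
    intro f hf hN
    have hother : ∀ n, n ≠ N + 1 → homogeneousComponent n f ∈ A := by
      intro n hn
      rcases le_or_gt n k with hnk | hnk
      · exact hlow f n hnk
      rcases lt_or_gt_of_ne hn with hlt | hgt
      -- subtracting the eigenvalue in degree `N + 1` kills the top part of `f`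
      · have hcomp : ∀ m, homogeneousComponent m
            (taylorCoeff k 0 f - (altChoose k (N + 1) : 𝕜) • f) =
            ((altChoose k m : 𝕜) - altChoose k (N + 1)) • homogeneousComponent m f := by
          intro m
          rw [map_sub, map_smul, homogeneousComponent_taylorCoeff_zero, sub_smul]
        have hmem := ih (taylorCoeff k 0 f - (altChoose k (N + 1) : 𝕜) • f)
          (A.sub_mem (hA.taylorCoeff_mem hkA (by simp) hf) (A.smul_mem _ hf))
          (fun m hm => by
            rw [hcomp]
            rcases eq_or_ne m (N + 1) with rfl | hm'
            · rw [sub_self, zero_smul]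
            · rw [hN m (by lia), smul_zero]) n
        rw [hcomp] at hmem
        refine (A.smul_mem_iff (sub_ne_zero.2 ?_)).1 hmem
        exact_mod_cast altChoose_ne_of_lt hk hnk hlt
      · rw [hN n hgt]
        exact A.zero_mem
    intro n
    rcases eq_or_ne n (N + 1) with rfl | hn
    · by_cases hdeg : f.totalDegree < N + 1
      · rw [homogeneousComponent_eq_zero _ _ hdeg]
        exact A.zero_mem
      · have hsum := sum_homogeneousComponent f
        rw [← Finset.add_sum_erase (Finset.range (f.totalDegree + 1)) _
          (Finset.mem_range.2 (show N + 1 < f.totalDegree + 1 by lia))] at hsum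
        rw [eq_sub_of_add_eq hsum]
        exact A.sub_mem hf (A.sum_mem fun i hi => hother i (Finset.ne_of_mem_erase hi))
    · exact hother n hn

theorem IsWronskianClosed.pderiv_mem [CharZero 𝕜] (hA : IsWronskianClosed k A)
    (hk : 1 ≤ k) (hkA : restrictTotalDegree (Fin d) 𝕜 k ≤ A) {n : ℕ}
    {f : MvPolynomial (Fin d) 𝕜} (hf : f ∈ A) (hfn : f.IsHomogeneous n) (i : Fin d) :
    pderiv i f ∈ A := by
  rcases le_or_gt n k with hnk | hnk
  · exact hkA ((mem_restrictTotalDegree _ _ _).2 (hfn.pderiv.totalDegree_le.trans (by lia)))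
  · have hdeg : (Finsupp.single i 1 : Fin d →₀ ℕ).degree = 1 := Finsupp.degree_single i 1
    have h := hA.taylorCoeff_mem hkA (t := Finsupp.single i 1) (by rw [hdeg]; exact hk) hf
    rw [taylorCoeff_of_isHomogeneous (by rw [hdeg]; exact hk) hfn, diffOp_single, hdeg] at h
    refine (A.smul_mem_iff ?_).1 h
    obtain ⟨m, rfl⟩ := Nat.exists_eq_add_of_le' (show 2 ≤ n by lia)
    rw [show m + 2 - 1 = m + 1 by lia, altChoose_succ]
    exact Int.cast_ne_zero.2 (mul_ne_zero (pow_ne_zero _ (by norm_num))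
      (Nat.cast_ne_zero.2 (Nat.choose_pos (by lia)).ne'))

/-- The Wronskian of `f`, `g` and of all divided powers of order at most `k` except `1` and `x^i`,
up to a nonzero constant. -/
theorem IsWronskianClosed.bracket_mem [CharZero 𝕜] (hA : IsWronskianClosed k A)
    (hk : 1 ≤ k) (hkA : restrictTotalDegree (Fin d) 𝕜 k ≤ A) {m n : ℕ} (hm : k < m) (hn : k < n)
    {f g : MvPolynomial (Fin d) 𝕜} (hf : f ∈ A) (hfm : f.IsHomogeneous m) (hg : g ∈ A)
    (hgn : g.IsHomogeneous n) (i : Fin d) :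
    ((m - 1 : ℕ) : 𝕜) • (f * pderiv i g) - ((n - 1 : ℕ) : 𝕜) • (g * pderiv i f) ∈ A := by
  have hdeg : (Finsupp.single i 1 : Fin d →₀ ℕ).degree = 1 := Finsupp.degree_single i 1
  have h := hA.taylorCoeff_mul_sub_mem hkA (t := 0) (t' := Finsupp.single i 1) (by simp)
    (by rw [hdeg]; exact hk) (by simp [eq_comm]) hf hg
  rw [taylorCoeff_of_isHomogeneous (t := 0) (by simp) hfm,
    taylorCoeff_of_isHomogeneous (t := 0) (by simp) hgn,
    taylorCoeff_of_isHomogeneous (t := Finsupp.single i 1) (by rw [hdeg]; exact hk) hfm,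
    taylorCoeff_of_isHomogeneous (t := Finsupp.single i 1) (by rw [hdeg]; exact hk) hgn] at h
  simp only [diffOp_single, diffOp_zero, hdeg, map_zero, tsub_zero] at h
  obtain ⟨m, rfl⟩ := Nat.exists_eq_add_of_le' (show 2 ≤ m by lia)
  obtain ⟨n, rfl⟩ := Nat.exists_eq_add_of_le' (show 2 ≤ n by lia)
  obtain ⟨q, rfl⟩ := Nat.exists_eq_add_of_le' hk
  simp only [show ∀ a : ℕ, a + 2 - 1 = a + 1 by lia, show ∀ a : ℕ, a + 2 = a + 1 + 1 by lia,
    altChoose_succ, add_tsub_cancel_right] at h ⊢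
  have hcm : (m.choose q : 𝕜) ≠ 0 := Nat.cast_ne_zero.2 (Nat.choose_pos (by lia)).ne'
  have hcn : (n.choose q : 𝕜) ≠ 0 := Nat.cast_ne_zero.2 (Nat.choose_pos (by lia)).ne'
  have hM : ((m : 𝕜) + 1) * m.choose q = (m + 1).choose (q + 1) * ((q : 𝕜) + 1) := by
    exact_mod_cast Nat.add_one_mul_choose_eq m q
  have hN : ((n : 𝕜) + 1) * n.choose q = (n + 1).choose (q + 1) * ((q : 𝕜) + 1) := by
    exact_mod_cast Nat.add_one_mul_choose_eq n q
  have hsq : ((-1 : 𝕜) ^ q) * (-1) ^ q = 1 := by rw [← mul_pow]; simp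
  -- by `(m + 1) C(m, q) = (q + 1) C(m + 1, q + 1)`, `q + 1` times the determinant `h` is
  -- `-C(m, q) C(n, q)` times the bracket
  refine (A.smul_mem_iff (neg_ne_zero.2 (mul_ne_zero hcm hcn))).1 ?_
  convert A.smul_mem ((q : 𝕜) + 1) h using 1
  push_cast
  simp only [smul_mul_smul_comm, smul_sub, smul_smul]
  rw [mul_comm g]
  congr 2
  · linear_combination (-(n.choose q : 𝕜)) * hM -
      ((q : 𝕜) + 1) * (m + 1).choose (q + 1) * n.choose q * (-1 : 𝕜) * (hsq)
  · linear_combination (-(m.choose q : 𝕜)) * hN -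
      ((q : 𝕜) + 1) * (n + 1).choose (q + 1) * m.choose q * (-1 : 𝕜) * (hsq)

/-! ### Polynomials with vanishing brackets -/

theorem totalDegree_pderiv_lt {i : Fin d} {f : MvPolynomial (Fin d) 𝕜} (h : pderiv i f ≠ 0) :
    (pderiv i f).totalDegree < f.totalDegree := by
  obtain ⟨s, hs, hdeg⟩ := Finset.exists_mem_eq_sup _ (support_nonempty.2 h)
    fun s => s.sum fun _ e => e
  have hs' : s + Finsupp.single i 1 ∈ f.support := by
    rw [mem_support_iff, coeff_pderiv] at hs
    exact mem_support_iff.2 (left_ne_zero_of_mul hs)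
  have hle := le_totalDegree hs'
  rw [Finsupp.sum_add_index' (fun _ => rfl) (fun _ _ _ => rfl),
    Finsupp.sum_single_index rfl] at hle
  rw [totalDegree, hdeg]
  lia

theorem pderiv_eq_zero_of_dvd {i : Fin d} {f : MvPolynomial (Fin d) 𝕜} (h : f ∣ pderiv i f) :
    pderiv i f = 0 := by
  by_contra h0
  obtain ⟨g, hg⟩ := h
  have hg0 : f ≠ 0 ∧ g ≠ 0 := by
    rw [hg] at h0
    exact mul_ne_zero_iff.1 h0
  have hlt := totalDegree_pderiv_lt h0
  rw [hg, totalDegree_mul_of_isDomain hg0.1 hg0.2] at hlt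
  lia

theorem eq_C_of_forall_pderiv_eq_zero [CharZero 𝕜] {f : MvPolynomial (Fin d) 𝕜}
    (h : ∀ i, pderiv i f = 0) : f = C (coeff 0 f) := by
  ext s
  rw [coeff_C]
  split_ifs with hs
  · rw [hs]
  · obtain ⟨i, hi⟩ := Finsupp.ne_iff.1 (Ne.symm hs)
    have hle : Finsupp.single i 1 ≤ s :=
      Finsupp.single_le_iff.2 (Nat.one_le_iff_ne_zero.2 hi)
    have hc := coeff_pderiv (i := i) f (s - Finsupp.single i 1)
    rw [h i, coeff_zero, tsub_add_cancel_of_le hle] at hc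
    exact (mul_eq_zero.1 hc.symm).resolve_right (Nat.cast_add_one_ne_zero _)

/-- Two polynomials with vanishing brackets `f ∂ᵢg - g ∂ᵢf` are proportional: after division by the
greatest common divisor, each of them divides its own derivatives. -/
theorem mem_span_singleton_of_bracket_eq_zero [CharZero 𝕜] {f g : MvPolynomial (Fin d) 𝕜}
    (hf : f ≠ 0) (h : ∀ i, f * pderiv i g = g * pderiv i f) : g ∈ Submodule.span 𝕜 {f} := by
  obtain ⟨a, b, c, hab, rfl, rfl⟩ := UniqueFactorizationMonoid.exists_reduced_factors f hf g
  have hc : c ≠ 0 := left_ne_zero_of_mul hf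
  have h' : ∀ i, a * pderiv i b = b * pderiv i a := by
    intro i
    have := h i
    rw [pderiv_mul, pderiv_mul] at this
    refine mul_left_cancel₀ (mul_ne_zero hc hc) ?_
    linear_combination this
  have ha : a = C (coeff 0 a) := eq_C_of_forall_pderiv_eq_zero fun i =>
    pderiv_eq_zero_of_dvd (hab.dvd_of_dvd_mul_left ⟨_, (h' i).symm⟩)
  have hb : b = C (coeff 0 b) := eq_C_of_forall_pderiv_eq_zero fun i =>
    pderiv_eq_zero_of_dvd (hab.symm.dvd_of_dvd_mul_left ⟨_, h' i⟩)
  have ha0 : coeff 0 a ≠ 0 := fun h0 => right_ne_zero_of_mul hf (by rw [ha, h0, C_0])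
  refine Submodule.mem_span_singleton.2 ⟨coeff 0 b / coeff 0 a, ?_⟩
  rw [ha, hb, smul_eq_C_mul, coeff_C, coeff_C, if_pos rfl, if_pos rfl, mul_left_comm, ← C_mul,
    div_mul_cancel₀ _ ha0]

/-! ### Lonely, chubby and lanky subspaces -/

theorem IsLonely.totalDegree_le (hA : IsLonely k A) {f : MvPolynomial (Fin d) 𝕜} (hf : f ∈ A) :
    f.totalDegree ≤ k + 1 := by
  obtain ⟨p, -, hp, rfl⟩ := hA
  rw [← mem_restrictTotalDegree]
  have hle : restrictTotalDegree (Fin d) 𝕜 k ⊔ Submodule.span 𝕜 {p} ≤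
      restrictTotalDegree (Fin d) 𝕜 (k + 1) := by
    refine sup_le (fun g hg => ?_) ?_
    · rw [mem_restrictTotalDegree] at hg ⊢
      lia
    · rw [Submodule.span_singleton_le_iff_mem, mem_restrictTotalDegree]
      exact hp.totalDegree_le
  exact hle hf

theorem IsLanky.not_isLonely (hA : IsLanky k A) : ¬ IsLonely k A := by
  obtain ⟨-, i, l, hl, hmem⟩ := hA
  intro h
  have := h.totalDegree_le hmem
  rw [totalDegree_X_pow] at this
  lia

theorem IsChubby.not_isLonely (hA : IsChubby k A) : ¬ IsLonely k A := by
  obtain ⟨p, q, -, -, hli, hdisj, hle⟩ := hA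
  rintro ⟨r, -, -, rfl⟩
  have hp : p ∈ restrictTotalDegree (Fin d) 𝕜 k ⊔ Submodule.span 𝕜 {r} :=
    hle (Submodule.mem_sup_right (Submodule.subset_span (by simp)))
  have hq : q ∈ restrictTotalDegree (Fin d) 𝕜 k ⊔ Submodule.span 𝕜 {r} :=
    hle (Submodule.mem_sup_right (Submodule.subset_span (by simp)))
  obtain ⟨p₀, hp₀, _, hpr, hp'⟩ := Submodule.mem_sup.1 hp
  obtain ⟨q₀, hq₀, _, hqr, hq'⟩ := Submodule.mem_sup.1 hq
  obtain ⟨a, rfl⟩ := Submodule.mem_span_singleton.1 hpr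
  obtain ⟨b, rfl⟩ := Submodule.mem_span_singleton.1 hqr
  have hpmem : p ∈ Submodule.span 𝕜 {p, q} := Submodule.subset_span (by simp)
  have hqmem : q ∈ Submodule.span 𝕜 {p, q} := Submodule.subset_span (by simp)
  -- this combination eliminates `r`
  have hcomb : b • p + (-a) • q = b • p₀ - a • q₀ := by
    rw [← hp', ← hq']
    module
  have hzero : b • p + (-a) • q = 0 := by
    refine Submodule.disjoint_def.1 hdisj _ ?_ ?_
    · rw [hcomb]
      exact Submodule.sub_mem _ (Submodule.smul_mem _ _ hp₀) (Submodule.smul_mem _ _ hq₀)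
    · exact Submodule.add_mem _ (Submodule.smul_mem _ _ hpmem) (Submodule.smul_mem _ _ hqmem)
  obtain ⟨-, ha⟩ := LinearIndependent.pair_iff.1 hli b (-a) hzero
  rw [neg_eq_zero] at ha
  rw [ha, zero_smul, add_zero] at hp'
  have hp0 : p = 0 := Submodule.disjoint_def.1 hdisj p (hp' ▸ hp₀) hpmem
  exact hli.ne_zero 0 hp0

theorem isChubby_of_notMem_span (hkA : restrictTotalDegree (Fin d) 𝕜 k ≤ A)
    {p q : MvPolynomial (Fin d) 𝕜} (hp : p ∈ A) (hq : q ∈ A) (hpk : p.IsHomogeneous (k + 1))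
    (hqk : q.IsHomogeneous (k + 1)) (hp0 : p ≠ 0) (hpq : q ∉ Submodule.span 𝕜 {p}) :
    IsChubby k A := by
  have hq0 : q ≠ 0 := fun h => hpq (h ▸ Submodule.zero_mem _)
  refine ⟨p, q, hpk.totalDegree hp0, hqk.totalDegree hq0, ?_, ?_, ?_⟩
  · exact (LinearIndependent.pair_iff' hp0).2 fun a ha =>
      hpq (Submodule.mem_span_singleton.2 ⟨a, ha⟩)
  · rw [Submodule.disjoint_def]
    intro f hf hfpq
    by_contra hf0
    have hspan : Submodule.span 𝕜 {p, q} ≤ homogeneousSubmodule (Fin d) 𝕜 (k + 1) := by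
      rw [Submodule.span_le]
      rintro _ (rfl | rfl)
      exacts [hpk, hqk]
    have hdeg := IsHomogeneous.totalDegree (hspan hfpq) hf0
    rw [mem_restrictTotalDegree] at hf
    lia
  · refine sup_le hkA (Submodule.span_le.2 ?_)
    rintro _ (rfl | rfl)
    exacts [hp, hq]

theorem IsWronskianClosed.exists_isHomogeneous [CharZero 𝕜] (hA : IsWronskianClosed k A)
    (hk : 1 ≤ k) (hcons : IsConsistent k A) :
    ∃ n, k < n ∧ ∃ f ∈ A, f ≠ 0 ∧ f.IsHomogeneous n := by
  obtain ⟨f, hf, hfk⟩ := SetLike.exists_of_lt hcons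
  by_contra! h
  refine hfk ?_
  rw [← sum_homogeneousComponent f]
  refine Submodule.sum_mem _ fun n _ => ?_
  rw [mem_restrictTotalDegree]
  rcases le_or_gt n k with hn | hn
  · exact (homogeneousComponent_isHomogeneous n f).totalDegree_le.trans hn
  · have h0 : homogeneousComponent n f = 0 := by
      by_contra h0
      exact h n hn _ (hA.homogeneousComponent_mem hk hcons.le hf n) h0
        (homogeneousComponent_isHomogeneous n f)
    rw [h0, totalDegree_zero]
    exact Nat.zero_le k

/-- A graded subspace whose part of degree `k + 1` is a line and which has no parts of higher
degree is lonely. -/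
theorem IsWronskianClosed.isLonely_of_forall [CharZero 𝕜] (hA : IsWronskianClosed k A)
    (hk : 1 ≤ k) (hkA : restrictTotalDegree (Fin d) 𝕜 k ≤ A) {p : MvPolynomial (Fin d) 𝕜}
    (hp : p ∈ A) (hp0 : p ≠ 0) (hpk : p.IsHomogeneous (k + 1))
    (hspan : ∀ q ∈ A, q.IsHomogeneous (k + 1) → q ∈ Submodule.span 𝕜 {p})
    (hmax : ∀ n, k + 1 < n → ∀ f ∈ A, f.IsHomogeneous n → f = 0) : IsLonely k A := by
  refine ⟨p, hp0, hpk, le_antisymm (fun f hf => ?_)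
    (sup_le hkA ((Submodule.span_singleton_le_iff_mem _ _).2 hp))⟩
  rw [← sum_homogeneousComponent f]
  refine Submodule.sum_mem _ fun n _ => ?_
  have hn := homogeneousComponent_isHomogeneous n f
  have hmem := hA.homogeneousComponent_mem hk hkA hf n
  rcases lt_trichotomy n (k + 1) with h | rfl | h
  · exact Submodule.mem_sup_left ((mem_restrictTotalDegree _ _ _).2
      (hn.totalDegree_le.trans (by lia)))
  · exact Submodule.mem_sup_right (hspan _ hmem hn)
  · rw [hmax n h _ hmem hn]
    exact Submodule.zero_mem _

/-! ### Infinite dimension -/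

theorem exists_forall_totalDegree_le_of_finiteDimensional (hfin : FiniteDimensional 𝕜 A) :
    ∃ N, ∀ f ∈ A, f.totalDegree ≤ N := by
  obtain ⟨S, rfl⟩ := (Submodule.fg_iff_finiteDimensional A).2 hfin
  refine ⟨S.sup totalDegree, fun f hf => ?_⟩
  rw [← mem_restrictTotalDegree]
  refine Submodule.span_le.2 (fun g hg => ?_) hf
  exact (mem_restrictTotalDegree _ _ _).2 (Finset.le_sup (f := totalDegree) hg)

/-- If the part of `A` of degree `m` is not a line, then `m` is not the top degree of `A`. -/
theorem IsWronskianClosed.mem_span_of_forall_eq_zero [CharZero 𝕜] (hA : IsWronskianClosed k A)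
    (hk : 1 ≤ k) (hkA : restrictTotalDegree (Fin d) 𝕜 k ≤ A) {m : ℕ} (hm : k < m)
    (hmax : ∀ n, m < n → ∀ f ∈ A, f.IsHomogeneous n → f = 0) {p q : MvPolynomial (Fin d) 𝕜}
    (hp : p ∈ A) (hp0 : p ≠ 0) (hpm : p.IsHomogeneous m) (hq : q ∈ A) (hqm : q.IsHomogeneous m) :
    q ∈ Submodule.span 𝕜 {p} := by
  refine mem_span_singleton_of_bracket_eq_zero hp0 fun i => ?_
  have h := hA.bracket_mem hk hkA hm hm hp hpm hq hqm i
  rw [← smul_sub] at h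
  have hm1 : ((m - 1 : ℕ) : 𝕜) ≠ 0 := Nat.cast_ne_zero.2 (by lia)
  exact sub_eq_zero.1 (hmax (m + (m - 1)) (by lia) _ ((A.smul_mem_iff hm1).1 h)
    ((hpm.mul hqm.pderiv).sub (hqm.mul hpm.pderiv)))

/-- The top degree of `A` cannot exceed `k + 1`: a form `p` of top degree and a derivative
`g = ∂ᵢp` would have vanishing brackets, and then Euler's identity gives
`(m - 1)² p g = m (m - 2) p g`. -/
theorem IsWronskianClosed.eq_succ_of_forall_eq_zero [CharZero 𝕜] (hA : IsWronskianClosed k A)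
    (hk : 1 ≤ k) (hkA : restrictTotalDegree (Fin d) 𝕜 k ≤ A) {m : ℕ} (hm : k < m)
    (hmax : ∀ n, m < n → ∀ f ∈ A, f.IsHomogeneous n → f = 0) {p : MvPolynomial (Fin d) 𝕜}
    (hp : p ∈ A) (hp0 : p ≠ 0) (hpm : p.IsHomogeneous m) : m = k + 1 := by
  by_contra hne
  obtain ⟨a, rfl⟩ := Nat.exists_eq_add_of_le' (show 2 ≤ m by lia)
  have hEuler := hpm.sum_X_mul_pderiv
  obtain ⟨i, hi⟩ : ∃ i, pderiv i p ≠ 0 := by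
    by_contra! h
    simp only [h, mul_zero, Finset.sum_const_zero] at hEuler
    exact smul_ne_zero (Nat.succ_ne_zero (a + 1)) hp0 hEuler.symm
  set g := pderiv i p with hg
  have hgm : g.IsHomogeneous (a + 1) := hpm.pderiv
  have hgA : g ∈ A := hA.pderiv_mem hk hkA hp hpm i
  have hbr : ∀ j, ((a + 1 : ℕ) : 𝕜) • (p * pderiv j g) = ((a : ℕ) : 𝕜) • (g * pderiv j p) := by
    intro j
    have h := hA.bracket_mem hk hkA hm (show k < a + 1 by lia) hp hpm hgA hgm j
    have h1 : (p * pderiv j g).IsHomogeneous (a + 2 + a) := hpm.mul hgm.pderiv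
    have h2 : (g * pderiv j p).IsHomogeneous (a + 2 + a) := by
      have := hgm.mul (hpm.pderiv (i := j))
      rwa [show a + 1 + (a + 2 - 1) = a + 2 + a by lia] at this
    exact sub_eq_zero.1 (hmax (a + 2 + a) (by lia) _ h
      (Submodule.sub_mem (homogeneousSubmodule (Fin d) 𝕜 (a + 2 + a))
        (Submodule.smul_mem _ _ h1) (Submodule.smul_mem _ _ h2)))
  have hEulerg := hgm.sum_X_mul_pderiv
  -- contract the vanishing brackets with `∑ⱼ xʲ` and apply Euler's identity to `p` and to `g`
  have hsum : ∑ j, X j * (((a + 1 : ℕ) : 𝕜) • (p * pderiv j g)) =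
      ∑ j, X j * (((a : ℕ) : 𝕜) • (g * pderiv j p)) :=
    Finset.sum_congr rfl fun j _ => by rw [hbr j]
  have hl : ∑ j, X j * (((a + 1 : ℕ) : 𝕜) • (p * pderiv j g)) =
      ((a + 1 : ℕ) : MvPolynomial (Fin d) 𝕜) * p * ((a + 1) • g) := by
    rw [← hEulerg, Finset.mul_sum]
    refine Finset.sum_congr rfl fun j _ => ?_
    rw [smul_eq_C_mul, map_natCast]
    ring
  have hr : ∑ j, X j * (((a : ℕ) : 𝕜) • (g * pderiv j p)) =
      (a : MvPolynomial (Fin d) 𝕜) * g * ((a + 2) • p) := by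
    rw [← hEuler, Finset.mul_sum]
    refine Finset.sum_congr rfl fun j _ => ?_
    rw [smul_eq_C_mul, map_natCast]
    ring
  rw [hl, hr, nsmul_eq_mul, nsmul_eq_mul] at hsum
  push_cast at hsum
  exact mul_ne_zero hp0 hi (by linear_combination hsum)

theorem IsWronskianClosed.not_finiteDimensional [CharZero 𝕜] (hA : IsWronskianClosed k A)
    (hk : 1 ≤ k) (hcons : IsConsistent k A) (hlonely : ¬ IsLonely k A) :
    ¬ FiniteDimensional 𝕜 A := by
  classical
  intro hfin
  obtain ⟨N, hN⟩ := exists_forall_totalDegree_le_of_finiteDimensional hfin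
  obtain ⟨n, hkn, f, hf, hf0, hfn⟩ := hA.exists_isHomogeneous hk hcons
  set P : ℕ → Prop := fun n => ∃ f ∈ A, f ≠ 0 ∧ f.IsHomogeneous n with hP
  have hPN : ∀ n, P n → n ≤ N := fun n ⟨f, hf, hf0, hfn⟩ => hfn.totalDegree hf0 ▸ hN f hf
  have hPn : P n := ⟨f, hf, hf0, hfn⟩
  set m := Nat.findGreatest P N with hm
  have hkm : k < m := hkn.trans_le (Nat.le_findGreatest (hPN n hPn) hPn)
  obtain ⟨p, hp, hp0, hpm⟩ : P m := Nat.findGreatest_spec (hPN n hPn) hPn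
  have hmax : ∀ n, m < n → ∀ f ∈ A, f.IsHomogeneous n → f = 0 := by
    intro n hn f hf hfn
    by_contra hf0
    have hPn : P n := ⟨f, hf, hf0, hfn⟩
    exact Nat.findGreatest_is_greatest hn (hPN n hPn) hPn
  have hmk := hA.eq_succ_of_forall_eq_zero hk hcons.le hkm hmax hp hp0 hpm
  rw [hmk] at hpm hmax
  exact hlonely (hA.isLonely_of_forall hk hcons.le hp hp0 hpm (fun q hq hqm =>
    hA.mem_span_of_forall_eq_zero hk hcons.le (Nat.lt_succ_self k) hmax hp hp0 hpm hq hqm) hmax)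

/-! ### Monomials in a closed subspace -/

theorem IsWronskianClosed.monomial_sub_single_mem [CharZero 𝕜] (hA : IsWronskianClosed k A)
    (hk : 1 ≤ k) (hkA : restrictTotalDegree (Fin d) 𝕜 k ≤ A) {s : Fin d →₀ ℕ} {i : Fin d}
    (hi : s i ≠ 0) (hs : monomial s (1 : 𝕜) ∈ A) :
    monomial (s - Finsupp.single i 1) (1 : 𝕜) ∈ A := by
  have h := hA.pderiv_mem hk hkA hs (isHomogeneous_monomial 1 rfl) i
  rw [pderiv_monomial, one_mul, ← mul_one (s i : 𝕜), ← smul_eq_mul, ← smul_monomial] at h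
  exact (A.smul_mem_iff (Nat.cast_ne_zero.2 hi)).1 h

theorem degree_sub_single {s : Fin d →₀ ℕ} {i : Fin d} (hi : s i ≠ 0) {n : ℕ}
    (hs : s.degree = n + 1) : (s - Finsupp.single i 1).degree = n := by
  have hle : Finsupp.single i 1 ≤ s := Finsupp.single_le_iff.2 (Nat.one_le_iff_ne_zero.2 hi)
  have h := congrArg Finsupp.degree (tsub_add_cancel_of_le hle)
  rw [map_add, Finsupp.degree_single] at h
  lia

theorem IsWronskianClosed.X_pow_mem [CharZero 𝕜] (hA : IsWronskianClosed k A)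
    (hk : 1 ≤ k) (hkA : restrictTotalDegree (Fin d) 𝕜 k ≤ A) {i : Fin d} {m n : ℕ} (hmn : m ≤ n)
    (h : (X i : MvPolynomial (Fin d) 𝕜) ^ n ∈ A) : (X i : MvPolynomial (Fin d) 𝕜) ^ m ∈ A := by
  induction n, hmn using Nat.le_induction with
  | base => exact h
  | succ n _ ih =>
    refine ih ?_
    rw [X_pow_eq_monomial] at h ⊢
    have := hA.monomial_sub_single_mem (s := Finsupp.single i (n + 1)) (i := i) hk hkA
      (by simp) h
    rwa [← Finsupp.single_tsub, Nat.add_sub_cancel] at this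

theorem IsWronskianClosed.exists_monomial_mem [CharZero 𝕜] (hA : IsWronskianClosed k A)
    (hk : 1 ≤ k) (hkA : restrictTotalDegree (Fin d) 𝕜 k ≤ A) {m n : ℕ} (hmn : m ≤ n)
    (h : ∃ s : Fin d →₀ ℕ, s.degree = n ∧ monomial s (1 : 𝕜) ∈ A) :
    ∃ s : Fin d →₀ ℕ, s.degree = m ∧ monomial s (1 : 𝕜) ∈ A := by
  induction n, hmn using Nat.le_induction with
  | base => exact h
  | succ n _ ih =>
    obtain ⟨s, hs, hsA⟩ := h
    obtain ⟨i, hi⟩ : ∃ i, s i ≠ 0 := by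
      by_contra! h0
      rw [show s = 0 from Finsupp.ext h0, map_zero] at hs
      lia
    exact ih ⟨_, degree_sub_single hi hs, hA.monomial_sub_single_mem hk hkA hi hsA⟩

theorem monomial_notMem_span_monomial {s t : Fin d →₀ ℕ} (h : s ≠ t) :
    monomial t (1 : 𝕜) ∉ Submodule.span 𝕜 {monomial s (1 : 𝕜)} := by
  rw [Submodule.mem_span_singleton]
  rintro ⟨a, ha⟩
  have := congrArg (coeff t) ha
  rw [coeff_smul, coeff_monomial, coeff_monomial, if_neg h, if_pos rfl, smul_zero] at this
  exact zero_ne_one this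

/-- A monomial of degree `k + 2` in `A` is a power of a coordinate, or has two different partial
derivatives. -/
theorem IsWronskianClosed.isChubby_or_isLanky_of_monomial_mem [CharZero 𝕜]
    (hA : IsWronskianClosed k A) (hk : 1 ≤ k) (hkA : restrictTotalDegree (Fin d) 𝕜 k ≤ A)
    {s : Fin d →₀ ℕ} (hs : s.degree = k + 2) (hsA : monomial s (1 : 𝕜) ∈ A) :
    IsChubby k A ∨ IsLanky k A := by
  obtain ⟨i, hi⟩ : ∃ i, s i ≠ 0 := by
    by_contra! h0
    rw [show s = 0 from Finsupp.ext h0, map_zero] at hs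
    lia
  by_cases h : ∃ j, j ≠ i ∧ s j ≠ 0
  · obtain ⟨j, hji, hj⟩ := h
    refine Or.inl (isChubby_of_notMem_span hkA
      (hA.monomial_sub_single_mem hk hkA hi hsA) (hA.monomial_sub_single_mem hk hkA hj hsA)
      (isHomogeneous_monomial 1 (degree_sub_single hi hs))
      (isHomogeneous_monomial 1 (degree_sub_single hj hs)) (by simp)
      (monomial_notMem_span_monomial fun heq => ?_))
    have := DFunLike.congr_fun heq i
    simp only [Finsupp.coe_tsub, Pi.sub_apply, Finsupp.single_eq_same,
      Finsupp.single_eq_of_ne hji.symm] at this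
    lia
  · push Not at h
    have hsi : s = Finsupp.single i (s i) := by
      ext j
      rcases eq_or_ne j i with rfl | hj
      · simp
      · rw [h j hj, Finsupp.single_eq_of_ne hj]
    refine Or.inr ⟨hkA, i, 2, le_rfl, ?_⟩
    rw [hsi, Finsupp.degree_single] at hs
    rwa [X_pow_eq_monomial, ← hs, ← hsi]

theorem IsWronskianClosed.isChubby_or_isLanky_of_isSpannedByMonomials [CharZero 𝕜]
    (hA : IsWronskianClosed k A) (hk : 1 ≤ k) (hcons : IsConsistent k A)
    (hmon : IsSpannedByMonomials A) (hlonely : ¬ IsLonely k A) :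
    IsChubby k A ∨ IsLanky k A := by
  obtain ⟨S, hS⟩ := hmon
  by_cases h : ∃ s ∈ S, k + 2 ≤ s.degree
  · obtain ⟨s, hsS, hs⟩ := h
    have hsA : monomial s (1 : 𝕜) ∈ A := hS ▸ Submodule.subset_span ⟨s, hsS, rfl⟩
    obtain ⟨s', hs', hsA'⟩ := hA.exists_monomial_mem hk hcons.le hs ⟨s, rfl, hsA⟩
    exact hA.isChubby_or_isLanky_of_monomial_mem hk hcons.le hs' hsA'
  · push Not at h
    have hle : A ≤ restrictTotalDegree (Fin d) 𝕜 (k + 1) := by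
      rw [hS, Submodule.span_le]
      rintro _ ⟨s, hs, rfl⟩
      refine (mem_restrictTotalDegree _ _ _).2
        ((isHomogeneous_monomial 1 rfl).totalDegree_le.trans ?_)
      have := h s hs
      lia
    have hmax : ∀ n, k + 1 < n → ∀ f ∈ A, f.IsHomogeneous n → f = 0 := by
      intro n hn f hf hfn
      by_contra hf0
      have h1 := (mem_restrictTotalDegree _ _ _).1 (hle hf)
      rw [hfn.totalDegree hf0] at h1
      lia
    obtain ⟨n, hkn, p, hp, hp0, hpn⟩ := hA.exists_isHomogeneous hk hcons
    have hn : n = k + 1 := by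
      by_contra hne
      exact hp0 (hmax n (by lia) p hp hpn)
    subst hn
    by_contra hno
    refine hlonely (hA.isLonely_of_forall hk hcons.le hp hp0 hpn (fun q hq hqn => ?_) hmax)
    by_contra hpq
    exact hno (Or.inl (isChubby_of_notMem_span hcons.le hp hq hpn hqn hp0 hpq))

end GenWronskian

end

theorem theorem2p1 {𝕜 : Type*} [RCLike 𝕜] (d k : ℕ) (hd : 1 ≤ d) (hk : 1 ≤ k)
    (A : Submodule 𝕜 (MvPolynomial (Fin d) 𝕜))
    (hA : GenWronskian.IsWronskianClosed k A) (hcons : GenWronskian.IsConsistent k A) :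
    -- a consistent algebra that is not lonely is infinite-dimensional
    (¬ GenWronskian.IsLonely k A → ¬ FiniteDimensional 𝕜 A) ∧
    -- chubby and lanky algebras are not lonely (hence they are infinite-dimensional)
    (GenWronskian.IsChubby k A ∨ GenWronskian.IsLanky k A →
      ¬ GenWronskian.IsLonely k A ∧ ¬ FiniteDimensional 𝕜 A) ∧
    -- with a high power of a coordinate, `A` contains the whole tower below it
    (∀ (i : Fin d) (l : ℕ), 2 ≤ l → (MvPolynomial.X i : MvPolynomial (Fin d) 𝕜) ^ (k + l) ∈ A →
      ∀ j : ℕ, 1 ≤ j → j ≤ l → (MvPolynomial.X i : MvPolynomial (Fin d) 𝕜) ^ (k + j) ∈ A) ∧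
    -- chubby or lanky exhausts the non-lonely algebras spanned by monomials
    (GenWronskian.IsSpannedByMonomials A →
      (¬ GenWronskian.IsLonely k A ↔ GenWronskian.IsChubby k A ∨ GenWronskian.IsLanky k A)) := by
  have hinf := hA.not_finiteDimensional hk hcons
  have hnot : GenWronskian.IsChubby k A ∨ GenWronskian.IsLanky k A →
      ¬ GenWronskian.IsLonely k A :=
    fun h => h.elim (fun h => h.not_isLonely) fun h => h.not_isLonely
  exact ⟨hinf, fun h => ⟨hnot h, hinf (hnot h)⟩,
    fun i l _ h j _ hj => hA.X_pow_mem hk hcons.le (Nat.add_le_add_left hj k) h,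
    fun hmon => ⟨hA.isChubby_or_isLanky_of_isSpannedByMonomials hk hcons hmon, hnot⟩⟩
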